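/- Let $X$ be a set of non-measurable cardinal, meaning that every prime ideal $I$ of the Boolean algebra $\mathcal{P}(X)$ which is closed under countable unions has the form $I=\{A\subseteq X: x\notin A\}$ for some $x\in X$. Let $\mathcal{A}$ be an infinite $\sigma$-field of subsets of $X$ (so that $X$ is infinite), and let $$\mathcal{M}(X,\mathcal{A})=\{f:X\to\mathbb{R} : f^{-1}(U)\in\mathcal{A}\text{ for every open }U\subseteq\mathbb{R}\}$$ be the ring, under pointwise operations, of real-valued $\mathcal{A}$-measurable functions. Let $\mathrm{Soc}(R)$ denote the socle of a commutative ring $R$, that is, the sum of all its minimal nonzero ideals. Then the factor ring $\mathcal{M}(X,\mathcal{A})/\mathrm{Soc}(\mathcal{M}(X,\mathcal{A}))$ is not self-injective. Here a commutative ring $R$ is self-injective if every $R$-module homomorphism from an ideal of $R$ to $R$ extends to an $R$-module homomorphism $R\to R$. -/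

import Mathlib

open scoped MeasureTheory

/-- The ring `M(X, 𝒜)` of all real-valued `𝒜`-measurable functions on `X`, as a subring of `X → ℝ`:
the functions `f` such that `f ⁻¹' U` belongs to the `σ`-field `𝒜` for every open `U ⊆ ℝ`. -/
def measurableFunctionRing {X : Type*} (𝒜 : MeasurableSpace X) : Subring (X → ℝ) where
  carrier := {f | ∀ U : Set ℝ, IsOpen U → MeasurableSet[𝒜] (f ⁻¹' U)}
  mul_mem' {f g} hf hg _ hU :=
    ((measurable_of_isOpen (f := f) hf).mul (measurable_of_isOpen (f := g) hg)) hU.measurableSet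
  one_mem' _ hU := (measurable_const (a := (1 : ℝ))) hU.measurableSet
  add_mem' {f g} hf hg _ hU :=
    ((measurable_of_isOpen (f := f) hf).add (measurable_of_isOpen (f := g) hg)) hU.measurableSet
  zero_mem' _ hU := (measurable_const (a := (0 : ℝ))) hU.measurableSet
  neg_mem' {f} hf _ hU := (measurable_of_isOpen (f := f) hf).neg hU.measurableSet

/-- The socle of a commutative ring: the sum of all its minimal nonzero ideals (the atoms of the
lattice of ideals). -/
def socle (R : Type*) [CommRing R] : Ideal R :=
  sSup {I : Ideal R | IsAtom I}

/-- A commutative ring `R` is self-injective if every `R`-linear map from an ideal of `R` to `R`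
extends to an `R`-linear map `R → R`. This is what `Module.Baer R R` says. -/
def IsSelfInjective (R : Type*) [CommRing R] : Prop :=
  Module.Baer R R

/-- A set `X` has a non-measurable cardinal if every (proper) prime ideal of the Boolean algebra of
all subsets of `X` that is closed under countable unions is `{A | x ∉ A}` for some point `x`. -/
def HasNonmeasurableCardinal (X : Type*) : Prop :=
  ∀ I : Order.Ideal (Set X), I.IsPrime →
    (∀ A : ℕ → Set X, (∀ n, A n ∈ I) → (⋃ n, A n) ∈ I) →
    ∃ x : X, ∀ A : Set X, A ∈ I ↔ x ∉ A

/-! The ring of measurable functions is von Neumann regular, so its ideals are governed by supports,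
and its socle consists of the functions vanishing off a finite union of atoms of the `σ`-field
(`socle_eq`). This ideal is radical. Self-injectivity of the quotient then gives, for any set `S` of
functions, an `h` that acts as the identity on `S` and kills the annihilator of `S`, modulo the
socle (`exists_unit_on_set_mod`).

With infinitely many atoms, a diagonal choice in an array of atoms contradicts this. With finitely
many, the socle is invisible off their union, and on that atomless remainder `Y` the supports of the
`h` are measurable hulls of arbitrary disjoint families. At a point of a nonempty `Y`, such hulls
yield a countably complete two-valued measure that is not fixed at any point, which the cardinality
hypothesis forbids. So `Y` is empty and the `σ`-field is finite. -/

section SelfInjective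

/-- In a reduced self-injective commutative ring, the annihilator of any set is cut out by a
single element acting as the identity on the set. -/
theorem IsSelfInjective.exists_unit_on_set {Q : Type*} [CommRing Q] [IsReduced Q]
    (hQ : IsSelfInjective Q) (S : Set Q) :
    ∃ h : Q, (∀ s ∈ S, h * s = s) ∧ ∀ a : Q, (∀ s ∈ S, a * s = 0) → h * a = 0 := by
  let J : Ideal Q := Ideal.span S
  let N : Ideal Q := Module.annihilator Q J
  have hN : ∀ a ∈ N, ∀ j ∈ J, a * j = 0 := fun a ha j hj => by
    have := Module.mem_annihilator.1 ha ⟨j, hj⟩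
    simpa using congrArg Subtype.val this
  -- The identity on `J` and zero on its annihilator `N` agree on `J ∩ N`, whose elements have
  -- square zero. The glued map extends to multiplication by the required element.
  let f : Q →ₗ.[Q] Q := ⟨J, J.subtype⟩
  let g : Q →ₗ.[Q] Q := ⟨N, 0⟩
  have hfg : ∀ (x : f.domain) (y : g.domain), (x : Q) = y → f x = g y := by
    rintro ⟨x, hx⟩ ⟨y, hy⟩ hxy
    obtain rfl : x = y := hxy
    have h0 : x * x = 0 := hN x hy x hx
    have hx0 : x = 0 := by
      have : x ^ 2 = 0 := by rw [sq, h0]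
      exact eq_zero_of_pow_eq_zero this
    change x = 0
    exact hx0
  obtain ⟨φ, hφ⟩ := hQ (f.sup g hfg).domain (f.sup g hfg).toFun
  have hmul : ∀ q, φ q = φ 1 * q := fun q => by
    have := φ.map_smul q 1
    rw [smul_eq_mul, mul_one, smul_eq_mul, mul_comm] at this
    exact this
  refine ⟨φ 1, fun s hs => ?_, fun a ha => ?_⟩
  · have hsJ : s ∈ J := Ideal.subset_span hs
    have hmem : s ∈ (f.sup g hfg).domain := (le_sup_left : J ≤ J ⊔ N) hsJ
    rw [← hmul, hφ s hmem]
    exact ((LinearPMap.left_le_sup f g hfg).2 (x := ⟨s, hsJ⟩) (y := ⟨s, hmem⟩) rfl).symm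
  · have haN : a ∈ N := by
      refine Module.mem_annihilator.2 ?_
      rintro ⟨j, hj⟩
      apply Subtype.ext
      change a * j = 0
      induction hj using Submodule.span_induction with
      | mem x hx => exact ha x hx
      | zero => simp
      | add x y _ _ hx hy => rw [mul_add, hx, hy, add_zero]
      | smul c x _ hx => rw [smul_eq_mul, mul_left_comm, hx, mul_zero]
    have hmem : a ∈ (f.sup g hfg).domain := (le_sup_right : N ≤ J ⊔ N) haN
    rw [← hmul, hφ a hmem]
    exact ((LinearPMap.right_le_sup f g hfg).2 (x := ⟨a, haN⟩) (y := ⟨a, hmem⟩) rfl).symm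

/-- The version of `IsSelfInjective.exists_unit_on_set` for a quotient by a radical ideal, stated
in the ring itself. -/
theorem IsSelfInjective.exists_unit_on_set_mod {R : Type*} [CommRing R] {I : Ideal R}
    (hI : I.IsRadical) (h : IsSelfInjective (R ⧸ I)) (S : Set R) :
    ∃ h : R, (∀ s ∈ S, h * s - s ∈ I) ∧ ∀ a : R, (∀ s ∈ S, a * s ∈ I) → h * a ∈ I := by
  have : IsReduced (R ⧸ I) := (Ideal.isRadical_iff_quotient_reduced I).1 hI
  obtain ⟨q, hq, hq'⟩ := h.exists_unit_on_set (Ideal.Quotient.mk I '' S)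
  obtain ⟨h, rfl⟩ := Ideal.Quotient.mk_surjective q
  refine ⟨h, fun s hs => ?_, fun a ha => ?_⟩
  · rw [← Ideal.Quotient.eq, map_mul]
    exact hq _ ⟨s, hs, rfl⟩
  · rw [← Ideal.Quotient.eq_zero_iff_mem, map_mul]
    refine hq' _ ?_
    rintro _ ⟨s, hs, rfl⟩
    rw [← map_mul, Ideal.Quotient.eq_zero_iff_mem]
    exact ha s hs

end SelfInjective

/-- An atom of a `σ`-field: a nonempty measurable set without proper nonempty measurable subset. -/
structure IsSetAtom {X : Type*} [MeasurableSpace X] (a : Set X) : Prop where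
  measurableSet : MeasurableSet a
  nonempty : a.Nonempty
  eq_of_subset : ∀ B : Set X, MeasurableSet B → B ⊆ a → B.Nonempty → B = a

section Atoms

variable {X : Type*} [MeasurableSpace X]

theorem IsSetAtom.subset_of_inter_nonempty {a B : Set X} (ha : IsSetAtom a)
    (hB : MeasurableSet B) (h : (B ∩ a).Nonempty) : a ⊆ B := by
  have := ha.eq_of_subset _ (hB.inter ha.measurableSet) Set.inter_subset_right h
  rw [← this]
  exact Set.inter_subset_left

theorem IsSetAtom.eq_of_mem {a b : Set X} (ha : IsSetAtom a) (hb : IsSetAtom b) {x : X}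
    (hxa : x ∈ a) (hxb : x ∈ b) : a = b :=
  (ha.subset_of_inter_nonempty hb.measurableSet ⟨x, hxb, hxa⟩).antisymm
    (hb.subset_of_inter_nonempty ha.measurableSet ⟨x, hxa, hxb⟩)

/-- If finitely many atoms cover the space, then the `σ`-field is finite. -/
theorem finite_measurableSets_of_finite_atoms (hfin : {a : Set X | IsSetAtom a}.Finite)
    (hcov : ⋃₀ {a : Set X | IsSetAtom a} = Set.univ) :
    {A : Set X | MeasurableSet A}.Finite := by
  refine (hfin.finite_subsets.image Set.sUnion).subset fun A hA => ?_
  refine ⟨{a | IsSetAtom a ∧ a ⊆ A}, fun a ha => ha.1, ?_⟩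
  refine Set.Subset.antisymm (Set.sUnion_subset fun a ha => ha.2) fun x hx => ?_
  obtain ⟨a, ha, hxa⟩ : x ∈ ⋃₀ {a : Set X | IsSetAtom a} := hcov ▸ Set.mem_univ x
  exact ⟨a, ⟨ha, IsSetAtom.subset_of_inter_nonempty ha hA ⟨x, hx, hxa⟩⟩, hxa⟩

end Atoms

/-- On a set of nonmeasurable cardinal, a measurable set containing no atoms of the `σ`-field, in
which all disjoint families have measurable hulls, is empty. -/
theorem HasNonmeasurableCardinal.eq_empty_of_hulls {X : Type*} [MeasurableSpace X]
    (hX : HasNonmeasurableCardinal X) {Y : Set X} (hY : MeasurableSet Y)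
    (hatom : ∀ a, IsSetAtom a → ¬ a ⊆ Y)
    (hhull : ∀ F : Set (Set X), (∀ D ∈ F, MeasurableSet D ∧ D ⊆ Y) → F.PairwiseDisjoint id →
      ∃ E, MeasurableSet E ∧ ⋃₀ F ⊆ E ∧
        ∀ B, MeasurableSet B → B ⊆ Y → ⋃₀ F ⊆ B → E ⊆ B) : Y = ∅ := by
  by_contra hne
  obtain ⟨x, hx⟩ := Set.nonempty_iff_ne_empty.2 hne
  -- By maximality, any nonempty measurable part of `Y` that misses `x` meets a member of the
  -- family.
  let good : Set (Set (Set X)) :=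
    {F | (∀ D ∈ F, MeasurableSet D ∧ D ⊆ Y ∧ D.Nonempty ∧ x ∉ D) ∧ F.PairwiseDisjoint id}
  obtain ⟨F, hF⟩ : ∃ F, Maximal (· ∈ good) F := by
    refine zorn_subset good fun c hc hchain => ⟨⋃₀ c, ⟨?_, ?_⟩, fun s hs => ?_⟩
    · rintro D ⟨s, hs, hD⟩
      exact (hc hs).1 D hD
    · exact (Set.pairwiseDisjoint_sUnion hchain.directedOn).2 fun s hs => (hc hs).2
    · exact Set.subset_sUnion_of_mem hs
  have hFg : ∀ D ∈ F, MeasurableSet D ∧ D ⊆ Y ∧ D.Nonempty ∧ x ∉ D := hF.prop.1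
  have hFd : F.PairwiseDisjoint id := hF.prop.2
  have hmax : ∀ C, MeasurableSet C → C ⊆ Y → x ∉ C → C.Nonempty → ¬ ∀ D ∈ F, Disjoint C D := by
    intro C hC hCY hxC hCn hdis
    have hCF : C ∈ F := by
      refine hF.le_of_ge (y := insert C F) ⟨?_, ?_⟩ (Set.subset_insert _ _)
        (Set.mem_insert _ _)
      · rintro D (rfl | hD)
        · exact ⟨hC, hCY, hCn, hxC⟩
        · exact hFg D hD
      · exact hFd.insert fun D hD _ => hdis D hD
    exact hCn.ne_empty (disjoint_self.1 (hdis C hCF))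
  have : Nonempty X := ⟨x⟩
  -- One point per member: subfamilies of `F` are now indexed by subsets of `X` itself, where the
  -- cardinality hypothesis applies.
  choose! r hr using fun D hD => (hFg D hD).2.2.1
  have hsub : ∀ A : Set X, ∃ E, MeasurableSet E ∧ ⋃₀ {D ∈ F | r D ∈ A} ⊆ E ∧
      ∀ B, MeasurableSet B → B ⊆ Y → ⋃₀ {D ∈ F | r D ∈ A} ⊆ B → E ⊆ B := fun A =>
    hhull _ (fun D hD => ⟨(hFg D hD.1).1, (hFg D hD.1).2.1⟩) (hFd.subset fun D hD => hD.1)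
  choose E hEm hEF hEmin using hsub
  have hEY : ∀ A, E A ⊆ Y := fun A =>
    hEmin A Y hY subset_rfl (Set.sUnion_subset fun D hD => (hFg D hD.1).2.1)
  have hmono : ∀ {A B : Set X}, A ⊆ B → E A ⊆ E B := fun {A B} hAB =>
    hEmin A _ (hEm B) (hEY B) (Set.sUnion_subset fun D hD =>
      (Set.subset_sUnion_of_mem (show D ∈ {D ∈ F | r D ∈ B} from ⟨hD.1, hAB hD.2⟩)).trans (hEF B))
  have hdis : ∀ A, Disjoint (E A) (E Aᶜ) := by
    intro A
    have h1 : ⋃₀ {D ∈ F | r D ∈ Aᶜ} ⊆ Y \ E A := by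
      rintro y ⟨D, ⟨hDF, hDA⟩, hyD⟩
      refine ⟨(hFg D hDF).2.1 hyD, fun hy => ?_⟩
      refine (hEmin A (Y \ D) (hY.diff (hFg D hDF).1) Set.sdiff_subset ?_ hy).2 hyD
      rintro z ⟨D', ⟨hDF', hDA'⟩, hzD'⟩
      refine ⟨(hFg D' hDF').2.1 hzD', fun hzD => ?_⟩
      have : D' = D := hFd.elim_set hDF' hDF z hzD' hzD
      exact hDA (this ▸ hDA')
    exact (disjoint_sdiff_self_right (x := E A) (y := Y)).mono_right
      (hEmin _ _ (hY.diff (hEm A)) Set.sdiff_subset h1)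
  have hiUnion : ∀ A : ℕ → Set X, E (⋃ n, A n) ⊆ ⋃ n, E (A n) := by
    intro A
    refine hEmin _ _ (MeasurableSet.iUnion fun n => hEm _) (Set.iUnion_subset fun n => hEY _) ?_
    rintro y ⟨D, ⟨hDF, hDA⟩, hyD⟩
    obtain ⟨n, hn⟩ := Set.mem_iUnion.1 hDA
    exact Set.mem_iUnion.2 ⟨n, hEF _ ⟨D, ⟨hDF, hn⟩, hyD⟩⟩
  have hunion : ∀ A B : Set X, E (A ∪ B) ⊆ E A ∪ E B := by
    intro A B
    refine hEmin _ _ ((hEm A).union (hEm B)) (Set.union_subset (hEY A) (hEY B)) ?_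
    rintro y ⟨D, ⟨hDF, hDA | hDB⟩, hyD⟩
    · exact Or.inl (hEF _ ⟨D, ⟨hDF, hDA⟩, hyD⟩)
    · exact Or.inr (hEF _ ⟨D, ⟨hDF, hDB⟩, hyD⟩)
  -- Otherwise `Y \ E Set.univ` is an atom: if it split, the piece missing `x` would contradict the
  -- maximality of `F`.
  have hcover : x ∈ E Set.univ := by
    by_contra hxE
    have hdisj : ∀ C, C ⊆ Y \ E Set.univ → ∀ D ∈ F, Disjoint C D := fun C hC D hD =>
      Set.disjoint_left.2 fun y hyC hyD => (hC hyC).2 (hEF _ ⟨D, ⟨hD, Set.mem_univ _⟩, hyD⟩)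
    have hCm : MeasurableSet (Y \ E Set.univ) := hY.diff (hEm _)
    refine hatom (Y \ E Set.univ) ⟨hCm, ⟨x, hx, hxE⟩, fun B hB hBC hBn => ?_⟩ Set.sdiff_subset
    by_cases hxB : x ∈ B
    · by_contra hBne
      refine hmax ((Y \ E Set.univ) \ B) (hCm.diff hB)
        (Set.sdiff_subset.trans Set.sdiff_subset) (fun h => h.2 hxB) ?_ (hdisj _ Set.sdiff_subset)
      exact Set.sdiff_nonempty.2 fun h => hBne (hBC.antisymm h)
    · exact absurd (hdisj B hBC) (hmax B hB (hBC.trans Set.sdiff_subset) hxB hBn)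
  have hempty : x ∉ E ∅ := fun h =>
    hEmin ∅ ∅ MeasurableSet.empty (Set.empty_subset _) (by simp) h
  let I : Order.Ideal (Set X) :=
    { carrier := {A | x ∉ E A}
      lower' := fun A B hBA hA hB => hA (hmono hBA hB)
      nonempty' := ⟨∅, hempty⟩
      directed' := fun A hA B hB =>
        ⟨A ∪ B, fun h => (hunion A B h).elim hA hB, Set.subset_union_left,
          Set.subset_union_right⟩ }
  have hmemI : ∀ A, A ∈ I ↔ x ∉ E A := fun A => Iff.rfl
  have hprop : I.IsProper := by
    refine Order.Ideal.isProper_of_notMem (p := Set.univ) ?_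
    rw [hmemI]
    exact not_not.2 hcover
  have hprime : I.IsPrime := by
    refine Order.Ideal.isPrime_of_mem_or_compl_mem fun {A} => ?_
    by_cases h : x ∈ E A
    · exact Or.inr fun h' => (Set.disjoint_left.1 (hdis A)) h h'
    · exact Or.inl h
  obtain ⟨y, hy⟩ := hX I hprime fun A hA h => by
    obtain ⟨n, hn⟩ := Set.mem_iUnion.1 (hiUnion A h)
    exact hA n hn
  -- But `E {y}` lies in the only member that can have `y` as its chosen point, and that member
  -- misses `x`; with no such member, `E {y}` is empty.
  have hxy : x ∈ E {y} := by
    by_contra h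
    exact (hy {y}).1 h rfl
  by_cases hD : ∃ D ∈ F, r D = y
  · obtain ⟨D, hDF, hDy⟩ := hD
    refine (hFg D hDF).2.2.2 (hEmin {y} D (hFg D hDF).1 (hFg D hDF).2.1 ?_ hxy)
    refine Set.sUnion_subset fun D' hD' => ?_
    have : D' = D := hFd.elim_set hD'.1 hDF y
      ((show r D' = y from hD'.2) ▸ hr D' hD'.1) (hDy ▸ hr D hDF)
    exact this.subset
  · refine hEmin {y} ∅ MeasurableSet.empty (Set.empty_subset _) ?_ hxy
    exact Set.sUnion_subset fun D' hD' => absurd ⟨D', hD'.1, hD'.2⟩ hD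

/-! ### The ring of measurable functions and its socle -/

section MeasurableFunctionRing

variable {X : Type*} [m : MeasurableSpace X]

theorem mem_measurableFunctionRing {f : X → ℝ} : f ∈ measurableFunctionRing m ↔ Measurable f :=
  ⟨fun h => measurable_of_isOpen h, fun h _ hU => h hU.measurableSet⟩

namespace measurableFunctionRing

theorem measurable (f : measurableFunctionRing m) : Measurable (f : X → ℝ) :=
  mem_measurableFunctionRing.1 f.2

/-- The characteristic function of a measurable set. -/
noncomputable def ind {A : Set X} (hA : MeasurableSet A) : measurableFunctionRing m :=
  ⟨A.indicator 1, mem_measurableFunctionRing.2 (measurable_one.indicator hA)⟩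

/-- The pointwise inverse, with value zero at the zeros of the function. -/
noncomputable def pinv (f : measurableFunctionRing m) : measurableFunctionRing m :=
  ⟨(f : X → ℝ)⁻¹, mem_measurableFunctionRing.2 (measurable f).inv⟩

theorem ind_of_mem {A : Set X} (hA : MeasurableSet A) {x : X} (hx : x ∈ A) :
    (ind hA : X → ℝ) x = 1 := by
  simp [ind, hx]

theorem ind_of_notMem {A : Set X} (hA : MeasurableSet A) {x : X} (hx : x ∉ A) :
    (ind hA : X → ℝ) x = 0 := by
  simp [ind, hx]

theorem mul_apply (f g : measurableFunctionRing m) (x : X) :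
    ((f * g : measurableFunctionRing m) : X → ℝ) x = (f : X → ℝ) x * (g : X → ℝ) x := rfl

theorem sub_apply (f g : measurableFunctionRing m) (x : X) :
    ((f - g : measurableFunctionRing m) : X → ℝ) x = (f : X → ℝ) x - (g : X → ℝ) x := rfl

theorem measurableSet_support (f : measurableFunctionRing m) :
    MeasurableSet {x | (f : X → ℝ) x ≠ 0} :=
  (measurable f) (measurableSet_singleton (0 : ℝ)).compl

theorem exists_ne_zero {f : measurableFunctionRing m} (hf : f ≠ 0) : ∃ x, (f : X → ℝ) x ≠ 0 := by
  by_contra! h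
  exact hf (Subtype.ext (funext h))

theorem eq_mul_of_support {f g : measurableFunctionRing m}
    (h : ∀ x, (f : X → ℝ) x = 0 → (g : X → ℝ) x = 0) : g = g * pinv f * f := by
  refine Subtype.ext (funext fun x => ?_)
  change (g : X → ℝ) x = (g : X → ℝ) x * ((f : X → ℝ) x)⁻¹ * (f : X → ℝ) x
  by_cases hx : (f : X → ℝ) x = 0
  · simp [hx, h x hx]
  · rw [inv_mul_cancel_right₀ hx]

/-- An ideal contains every function whose zero set contains that of some member. -/
theorem mem_of_support {I : Ideal (measurableFunctionRing m)} {f g : measurableFunctionRing m}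
    (hf : f ∈ I) (h : ∀ x, (f : X → ℝ) x = 0 → (g : X → ℝ) x = 0) : g ∈ I := by
  rw [eq_mul_of_support h]
  exact I.mul_mem_left _ hf

theorem eq_zero_of_mem_span {f g : measurableFunctionRing m} (hg : g ∈ Ideal.span {f}) {x : X}
    (hx : (f : X → ℝ) x = 0) : (g : X → ℝ) x = 0 := by
  obtain ⟨c, rfl⟩ := Ideal.mem_span_singleton'.1 hg
  rw [mul_apply, hx, mul_zero]

theorem isAtom_span_ind {a : Set X} (ha : IsSetAtom a) :
    IsAtom (Ideal.span {ind ha.measurableSet}) := by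
  refine ⟨fun h => ?_, fun I hI => ?_⟩
  · obtain ⟨x, hx⟩ := ha.nonempty
    have h0 : ind ha.measurableSet = 0 := Ideal.span_singleton_eq_bot.1 h
    have h1 := ind_of_mem ha.measurableSet hx
    rw [h0] at h1
    exact zero_ne_one h1
  · by_contra hne
    obtain ⟨g, hg, hg0⟩ := Submodule.exists_mem_ne_zero_of_ne_bot hne
    obtain ⟨x, hx⟩ := exists_ne_zero hg0
    have hsub : {x | (g : X → ℝ) x ≠ 0} ⊆ a := fun y hy => by
      by_contra hya
      exact hy (eq_zero_of_mem_span (hI.le hg) (ind_of_notMem ha.measurableSet hya))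
    have hsupp := ha.eq_of_subset _ (measurableSet_support g) hsub ⟨x, hx⟩
    refine hI.not_ge ((Ideal.span_singleton_le_iff_mem I).2 (mem_of_support hg fun y hy => ?_))
    refine ind_of_notMem _ fun hya => ?_
    rw [← hsupp] at hya
    exact hya hy

/-- Any nonzero element generates a minimal ideal, so all nonzero elements have the same support;
that support is the atom. -/
theorem exists_isSetAtom_of_isAtom {I : Ideal (measurableFunctionRing m)} (hI : IsAtom I) :
    ∃ a, IsSetAtom a ∧ ∀ f ∈ I, ∀ x ∉ a, (f : X → ℝ) x = 0 := by
  obtain ⟨g, hg, hg0⟩ := Submodule.exists_mem_ne_zero_of_ne_bot hI.1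
  have key : ∀ k ∈ I, k ≠ 0 → ∀ f ∈ I, ∀ x, (k : X → ℝ) x = 0 → (f : X → ℝ) x = 0 := by
    intro k hk hk0 f hf x hx
    have hspan : Ideal.span {k} = I :=
      (hI.le_iff.1 ((Ideal.span_singleton_le_iff_mem I).2 hk)).resolve_left
        fun h => hk0 (Ideal.span_singleton_eq_bot.1 h)
    exact eq_zero_of_mem_span (hspan ▸ hf) hx
  refine ⟨{x | (g : X → ℝ) x ≠ 0}, ⟨measurableSet_support g, exists_ne_zero hg0, ?_⟩,
    fun f hf x hx => key g hg hg0 f hf x (not_not.1 hx)⟩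
  intro B hB hBg hBn
  refine hBg.antisymm fun x hx => ?_
  by_contra hxB
  have hBI : ind hB ∈ I := mem_of_support hg fun y hy => ind_of_notMem hB fun hyB => hBg hyB hy
  refine hx (key (ind hB) hBI (fun h0 => ?_) g hg x (ind_of_notMem hB hxB))
  obtain ⟨y, hy⟩ := hBn
  have h1 := ind_of_mem hB hy
  rw [h0] at h1
  exact zero_ne_one h1

theorem ind_mem_socle {T : Set (Set X)} (hT : T.Finite) (hatom : ∀ a ∈ T, IsSetAtom a)
    (hm : MeasurableSet (⋃₀ T)) : ind hm ∈ socle (measurableFunctionRing m) := by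
  induction T, hT using Set.Finite.induction_on with
  | empty =>
    convert Ideal.zero_mem (socle (measurableFunctionRing m))
    exact Subtype.ext (funext fun x => ind_of_notMem _ (by simp))
  | @insert a T _ hT ih =>
    have ha := hatom a (Set.mem_insert _ _)
    have hT' : ∀ b ∈ T, IsSetAtom b := fun b hb => hatom b (Set.mem_insert_of_mem _ hb)
    have hTm : MeasurableSet (⋃₀ T) :=
      MeasurableSet.sUnion hT.countable fun b hb => (hT' b hb).measurableSet
    have h1 : ind ha.measurableSet ∈ socle (measurableFunctionRing m) :=
      (le_sSup (isAtom_span_ind ha) : _ ≤ socle (measurableFunctionRing m))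
        (Ideal.mem_span_singleton_self _)
    have h2 := ih hT' hTm
    -- The factor `1 - ind ha.measurableSet` makes disjointness of `a` from `⋃₀ T` unnecessary.
    have heq : ind hm = ind ha.measurableSet + (1 - ind ha.measurableSet) * ind hTm := by
      refine Subtype.ext (funext fun x => ?_)
      change (ind hm : X → ℝ) x = (ind ha.measurableSet : X → ℝ) x +
        (1 - (ind ha.measurableSet : X → ℝ) x) * (ind hTm : X → ℝ) x
      by_cases hxa : x ∈ a
      · rw [ind_of_mem _ hxa, ind_of_mem _ (by simp [hxa])]
        ring
      · by_cases hxT : x ∈ ⋃₀ T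
        · rw [ind_of_notMem _ hxa, ind_of_mem _ hxT,
            ind_of_mem _ (by rw [Set.sUnion_insert]; exact Or.inr hxT)]
          ring
        · rw [ind_of_notMem _ hxa, ind_of_notMem _ hxT,
            ind_of_notMem _ (by rw [Set.sUnion_insert]; exact fun h => h.elim hxa hxT)]
          ring
    rw [heq]
    exact Ideal.add_mem _ h1 (Ideal.mul_mem_left _ _ h2)

/-- The ideal of functions vanishing off a finite union of atoms. -/
def finiteAtomIdeal (X : Type*) [m : MeasurableSpace X] : Ideal (measurableFunctionRing m) where
  carrier := {f | ∃ T : Set (Set X), T.Finite ∧ (∀ a ∈ T, IsSetAtom a) ∧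
    ∀ x ∉ ⋃₀ T, (f : X → ℝ) x = 0}
  zero_mem' := ⟨∅, Set.finite_empty, by simp, fun _ _ => rfl⟩
  add_mem' := by
    rintro f g ⟨T, hT, hTa, hf⟩ ⟨U, hU, hUa, hg⟩
    refine ⟨T ∪ U, hT.union hU, fun a ha => ha.elim (hTa a) (hUa a), fun x hx => ?_⟩
    rw [Set.sUnion_union] at hx
    change (f : X → ℝ) x + (g : X → ℝ) x = 0
    rw [hf x fun h => hx (Or.inl h), hg x fun h => hx (Or.inr h), add_zero]
  smul_mem' := by
    rintro c f ⟨T, hT, hTa, hf⟩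
    refine ⟨T, hT, hTa, fun x hx => ?_⟩
    change (c : X → ℝ) x * (f : X → ℝ) x = 0
    rw [hf x hx, mul_zero]

theorem socle_eq : socle (measurableFunctionRing m) = finiteAtomIdeal X := by
  refine le_antisymm (sSup_le fun I hI f hf => ?_) fun f hf => ?_
  · obtain ⟨a, ha, h⟩ := exists_isSetAtom_of_isAtom hI
    exact ⟨{a}, Set.finite_singleton a, by simpa using ha, by simpa using h f hf⟩
  · obtain ⟨T, hT, hTa, h⟩ := hf
    have hm : MeasurableSet (⋃₀ T) :=
      MeasurableSet.sUnion hT.countable fun b hb => (hTa b hb).measurableSet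
    refine mem_of_support (ind_mem_socle hT hTa hm) fun x hx => h x fun hxT => ?_
    rw [ind_of_mem hm hxT] at hx
    exact one_ne_zero hx

theorem isRadical_finiteAtomIdeal : (finiteAtomIdeal X).IsRadical := by
  rintro f ⟨n, T, hT, hTa, h⟩
  exact ⟨T, hT, hTa, fun x hx => eq_zero_of_pow_eq_zero (n := n) (h x hx)⟩

/-- A function in the ideal vanishes on all but finitely many members of a sequence of distinct
atoms. -/
theorem finite_nonvanishing {f : measurableFunctionRing m} (hf : f ∈ finiteAtomIdeal X)
    {ι : Type*} {a : ι → Set X} (ha : ∀ i, IsSetAtom (a i)) (hinj : Function.Injective a) :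
    {i | ∃ x ∈ a i, (f : X → ℝ) x ≠ 0}.Finite := by
  obtain ⟨T, hT, hTa, h⟩ := hf
  refine (hT.preimage hinj.injOn).subset ?_
  rintro i ⟨x, hxi, hx⟩
  by_contra hi
  refine hx (h x ?_)
  rintro ⟨b, hb, hxb⟩
  have hab : a i = b := (ha i).eq_of_mem (hTa b hb) hxi hxb
  exact hi (show a i ∈ T from hab ▸ hb)

/-- Arrange atoms in an array and take `h` for the indicators of the rows. In each row `h` is `1` on
all but finitely many atoms; pick one such atom per row, with union `P`. Since `P` meets each row in
one atom, `ind hP` annihilates the rows modulo the socle, yet `h * ind hP` is `1` on infinitely many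
atoms. -/
theorem not_isSelfInjective_of_infinite_atoms (hinf : {a : Set X | IsSetAtom a}.Infinite) :
    ¬ IsSelfInjective (measurableFunctionRing m ⧸ finiteAtomIdeal X) := by
  intro hself
  let e := hinf.natEmbedding
  let a : ℕ × ℕ → Set X := fun p => e (Nat.pair p.1 p.2)
  have ha : ∀ p, IsSetAtom (a p) := fun p => (e _).2
  have hinj : Function.Injective a := fun p q h => by
    have := Nat.pair_eq_pair.1 (e.injective (Subtype.ext h))
    exact Prod.ext this.1 this.2
  have hrow : ∀ k, MeasurableSet (⋃ n, a (k, n)) := fun k =>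
    MeasurableSet.iUnion fun n => (ha _).measurableSet
  obtain ⟨h, h1, h2⟩ := hself.exists_unit_on_set_mod isRadical_finiteAtomIdeal
    (Set.range fun k => ind (hrow k))
  have hone : ∀ k, ∃ n, ∀ x ∈ a (k, n), (h : X → ℝ) x = 1 := by
    intro k
    have hfin := finite_nonvanishing (h1 _ ⟨k, rfl⟩) (a := fun n => a (k, n)) (fun n => ha _)
      fun n n' hn => (Prod.ext_iff.1 (hinj hn)).2
    obtain ⟨n, hn⟩ := hfin.exists_notMem
    refine ⟨n, fun x hx => ?_⟩
    by_contra hne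
    refine hn ⟨x, hx, ?_⟩
    rw [sub_apply, mul_apply, ind_of_mem (hrow k) (Set.mem_iUnion.2 ⟨n, hx⟩), mul_one]
    exact sub_ne_zero.2 hne
  choose n hn using hone
  have hP : MeasurableSet (⋃ k, a (k, n k)) := MeasurableSet.iUnion fun k => (ha _).measurableSet
  have hmem : h * ind hP ∈ finiteAtomIdeal X := by
    refine h2 _ ?_
    rintro _ ⟨k, rfl⟩
    refine ⟨{a (k, n k)}, Set.finite_singleton _, by simpa using ha _, fun x hx => ?_⟩
    rw [Set.sUnion_singleton] at hx
    rw [mul_apply]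
    by_cases hxk : x ∈ ⋃ n, a (k, n)
    · rw [ind_of_notMem hP, zero_mul]
      intro hxP
      obtain ⟨l, hl⟩ := Set.mem_iUnion.1 hxP
      obtain ⟨i, hi⟩ := Set.mem_iUnion.1 hxk
      have := (Prod.ext_iff.1 (hinj ((ha _).eq_of_mem (ha _) hl hi))).1
      obtain rfl : l = k := this
      exact hx hl
    · rw [ind_of_notMem (hrow k) hxk, mul_zero]
  have hfin := finite_nonvanishing hmem (a := fun k => a (k, n k)) (fun k => ha _)
    fun k k' hk => (Prod.ext_iff.1 (hinj hk)).1
  obtain ⟨k, hk⟩ := hfin.exists_notMem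
  obtain ⟨x, hx⟩ := (ha (k, n k)).nonempty
  refine hk ⟨x, hx, ?_⟩
  rw [mul_apply, hn k x hx, ind_of_mem hP (Set.mem_iUnion.2 ⟨k, hx⟩), mul_one]
  exact one_ne_zero

theorem not_isSelfInjective_of_finite_atoms (hX : HasNonmeasurableCardinal X)
    (hinf : {A : Set X | MeasurableSet A}.Infinite) (hfin : {a : Set X | IsSetAtom a}.Finite) :
    ¬ IsSelfInjective (measurableFunctionRing m ⧸ finiteAtomIdeal X) := by
  intro hself
  have hU : MeasurableSet (⋃₀ {a : Set X | IsSetAtom a}) :=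
    MeasurableSet.sUnion hfin.countable fun a ha => IsSetAtom.measurableSet ha
  have hvanish : ∀ f ∈ finiteAtomIdeal X, ∀ x ∉ ⋃₀ {a : Set X | IsSetAtom a},
      (f : X → ℝ) x = 0 := by
    rintro f ⟨T, _, hTa, h⟩ x hx
    exact h x fun hxT => hx (Set.sUnion_subset_sUnion hTa hxT)
  refine hinf (finite_measurableSets_of_finite_atoms hfin (Set.compl_empty_iff.1 ?_))
  refine hX.eq_empty_of_hulls hU.compl (fun a ha hsub => ?_) fun F hF _ => ?_
  · obtain ⟨x, hx⟩ := ha.nonempty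
    exact hsub hx ⟨a, ha, hx⟩
  · obtain ⟨h, h1, h2⟩ := hself.exists_unit_on_set_mod isRadical_finiteAtomIdeal
      {s | ∃ (D : Set X) (hD : MeasurableSet D), D ∈ F ∧ s = ind hD}
    -- Off the atoms, `h` is `1` on each `D ∈ F`, and it vanishes outside any measurable `B ⊇ ⋃₀ F`
    -- because `ind hB.compl` annihilates the indicators of `F`.
    refine ⟨{x | (h : X → ℝ) x ≠ 0} ∩ (⋃₀ {a : Set X | IsSetAtom a})ᶜ,
      (measurableSet_support h).inter hU.compl, ?_, fun B hB _ hFB x hx => ?_⟩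
    · rintro x ⟨D, hD, hxD⟩
      refine ⟨fun h0 => ?_, (hF D hD).2 hxD⟩
      have := hvanish _ (h1 _ ⟨D, (hF D hD).1, hD, rfl⟩) x ((hF D hD).2 hxD)
      rw [sub_apply, mul_apply, h0, ind_of_mem _ hxD] at this
      norm_num at this
    · by_contra hxB
      have hmem : h * ind hB.compl ∈ finiteAtomIdeal X := by
        refine h2 _ ?_
        rintro _ ⟨D, hD, hDF, rfl⟩
        convert Ideal.zero_mem (finiteAtomIdeal X)
        refine Subtype.ext (funext fun y => ?_)
        rw [mul_apply]
        by_cases hy : y ∈ D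
        · rw [ind_of_notMem hB.compl fun hyB => hyB (hFB ⟨D, hDF, hy⟩), zero_mul]
          rfl
        · rw [ind_of_notMem hD hy, mul_zero]
          rfl
      have := hvanish _ hmem x hx.2
      rw [mul_apply, ind_of_mem hB.compl hxB, mul_one] at this
      exact hx.1 this

end measurableFunctionRing

end MeasurableFunctionRing

theorem corollary4p9 {X : Type*} (hX : HasNonmeasurableCardinal X)
    (𝒜 : MeasurableSpace X) (h𝒜 : {A : Set X | MeasurableSet[𝒜] A}.Infinite) :
    ¬ IsSelfInjective
        (measurableFunctionRing 𝒜 ⧸ socle (measurableFunctionRing 𝒜)) := by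
  rw [measurableFunctionRing.socle_eq]
  by_cases hfin : {a : Set X | IsSetAtom a}.Finite
  · exact measurableFunctionRing.not_isSelfInjective_of_finite_atoms hX h𝒜 hfin
  · exact measurableFunctionRing.not_isSelfInjective_of_infinite_atoms hfin
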